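/- Let $k$ be a field of characteristic different from $2$ and $3$, and let $L$ be a Mal'tsev algebra over $k$ (of any dimension), i.e. a $k$-vector space with a bilinear alternating bracket satisfying $[J(x,y,z),x]=J(x,y,[x,z])$, where $J(x,y,z)=[x,[y,z]]+[y,[z,x]]+[z,[x,y]]$. Let $U(L)$ be the quotient of the free unital nonassociative $k$-algebra on the vector space $L$ by the ideal imposing the relations $$xy-yx=[x,y],\qquad (x,h,g)+(h,x,g)=0,\qquad (h,x,g)+(h,g,x)=0$$ for all $x,y\in L$ and all $h,g$ in the free algebra, where $(a,b,c)=(ab)c-a(bc)$. Let $\Delta:U(L)\to U(L)\otimes U(L)$ and $\varepsilon:U(L)\to k$ be the homomorphisms of unital algebras, and $S:U(L)\to U(L)$ the linear antihomomorphism of unital algebras, with $$\Delta x=x\otimes 1+1\otimes x,\qquad \varepsilon(x)=0,\qquad Sx=-x\qquad(x\in L).$$ Then $U(L)$ with these maps is a Moufang Hopf quasigroup. That is, $\Delta$ and $\varepsilon$ are homomorphisms of unital algebras forming a coassociative counital coalgebra, and for all $h,g,f\in U(L)$, writing $\Delta h=h_{(1)}\otimes h_{(2)}$, $$S(h_{(1)})(h_{(2)}g)=\varepsilon(h)g=h_{(1)}(S(h_{(2)})g),\qquad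 (hS(g_{(1)}))g_{(2)}=h\,\varepsilon(g)=(hg_{(1)})S(g_{(2)}),$$ and the Moufang identity holds: $$h_{(1)}(g(h_{(2)}f))=((h_{(1)}g)h_{(2)})f .$$ -/

import Mathlib

open scoped TensorProduct

/-- A Mal'tsev algebra over `k`: a `k`-module `L` with a bilinear alternating bracket such that
`⁅J(x,y,z), x⁆ = J(x,y,⁅x,z⁆)` for `J(x,y,z) = ⁅x,⁅y,z⁆⁆ + ⁅y,⁅z,x⁆⁆ + ⁅z,⁅x,y⁆⁆`. -/
class MaltsevAlgebra (k L : Type*) [CommRing k] [AddCommGroup L] [Module k L]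
    extends Bracket L L where
  add_bracket : ∀ x y z : L, ⁅x + y, z⁆ = ⁅x, z⁆ + ⁅y, z⁆
  bracket_add : ∀ x y z : L, ⁅x, y + z⁆ = ⁅x, y⁆ + ⁅x, z⁆
  smul_bracket : ∀ (c : k) (x y : L), ⁅c • x, y⁆ = c • ⁅x, y⁆
  bracket_smul : ∀ (c : k) (x y : L), ⁅x, c • y⁆ = c • ⁅x, y⁆
  bracket_self : ∀ x : L, ⁅x, x⁆ = 0
  maltsev : ∀ x y z : L,
    ⁅⁅x, ⁅y, z⁆⁆ + ⁅y, ⁅z, x⁆⁆ + ⁅z, ⁅x, y⁆⁆, x⁆ =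
      ⁅x, ⁅y, ⁅x, z⁆⁆⁆ + ⁅y, ⁅⁅x, z⁆, x⁆⁆ + ⁅⁅x, z⁆, ⁅x, y⁆⁆

/-! ### Hopf quasigroups -/

section HopfQuasigroup

variable (k H : Type*) [CommRing k] [NonAssocRing H] [Module k H] [IsScalarTower k H H]
  [SMulCommClass k H H] [Coalgebra k H]

open Coalgebra LinearMap

/-- A possibly nonassociative unital algebra `H` which is also a (coassociative, counital)
coalgebra is a Hopf quasigroup with antipode `S` if `Δ` and `ε` are homomorphisms of unital
algebras and, in Sweedler notation,
`S(h₁)(h₂ g) = ε(h) g = h₁(S(h₂) g)` and `(h S(g₁)) g₂ = h ε(g) = (h g₁) S(g₂)`. -/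
structure IsHopfQuasigroup (S : H →ₗ[k] H) : Prop where
  comul_one : comul (R := k) (1 : H) = 1
  comul_mul : ∀ h g : H, comul (R := k) (h * g) = comul (R := k) h * comul (R := k) g
  counit_one : counit (R := k) (1 : H) = 1
  counit_mul : ∀ h g : H, counit (R := k) (h * g) = counit (R := k) h * counit (R := k) g
  /-- `m (id ⊗ m) (S ⊗ id ⊗ id) (Δ ⊗ id) = ε ⊗ id` -/
  antipode_mul_left :
    mul' k H ∘ₗ lTensor H (mul' k H) ∘ₗ TensorProduct.map S (TensorProduct.map id id) ∘ₗ
        (TensorProduct.assoc k H H H).toLinearMap ∘ₗ rTensor H comul =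
      (TensorProduct.lid k H).toLinearMap ∘ₗ rTensor H counit
  /-- `m (id ⊗ m) (id ⊗ S ⊗ id) (Δ ⊗ id) = ε ⊗ id` -/
  mul_antipode_left :
    mul' k H ∘ₗ lTensor H (mul' k H) ∘ₗ TensorProduct.map id (TensorProduct.map S id) ∘ₗ
        (TensorProduct.assoc k H H H).toLinearMap ∘ₗ rTensor H comul =
      (TensorProduct.lid k H).toLinearMap ∘ₗ rTensor H counit
  /-- `m (m ⊗ id) (id ⊗ S ⊗ id) (id ⊗ Δ) = id ⊗ ε` -/
  antipode_mul_right :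
    mul' k H ∘ₗ rTensor H (mul' k H) ∘ₗ TensorProduct.map (TensorProduct.map id S) id ∘ₗ
        (TensorProduct.assoc k H H H).symm.toLinearMap ∘ₗ lTensor H comul =
      (TensorProduct.rid k H).toLinearMap ∘ₗ lTensor H counit
  /-- `m (m ⊗ id) (id ⊗ id ⊗ S) (id ⊗ Δ) = id ⊗ ε` -/
  mul_antipode_right :
    mul' k H ∘ₗ rTensor H (mul' k H) ∘ₗ TensorProduct.map (TensorProduct.map id id) S ∘ₗ
        (TensorProduct.assoc k H H H).symm.toLinearMap ∘ₗ lTensor H comul =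
      (TensorProduct.rid k H).toLinearMap ∘ₗ lTensor H counit

/-- The Moufang identity `h₁(g(h₂ f)) = ((h₁ g)h₂) f` for all `h, g, f`, where
`Δ h = h₁ ⊗ h₂` in Sweedler notation, that is, `Δ h = ∑ i, a i ⊗ b i` is any expression of `Δ h`
as a finite sum of pure tensors. -/
def IsMoufang : Prop :=
  ∀ (h g f : H) (n : ℕ) (a b : Fin n → H), comul (R := k) h = ∑ i, a i ⊗ₜ[k] b i →
    ∑ i, a i * (g * (b i * f)) = ∑ i, ((a i * g) * b i) * f

end HopfQuasigroup

/-! ### The enveloping algebra of a Mal'tsev algebra -/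

namespace MaltsevAlgebra

noncomputable section

variable (k L : Type*) [CommRing k]

/-- The free unital nonassociative `k`-algebra on the set `L`: its basis consists of `1` and all
nonempty nonassociative words in elements of `L`. -/
abbrev FreeAlg := MonoidAlgebra k (WithOne (FreeMagma L))

variable {L} in
/-- The generator of the free algebra that belongs to `x`. -/
def gen (x : L) : FreeAlg k L := MonoidAlgebra.single (FreeMagma.of x : WithOne (FreeMagma L)) 1

section FreeLift

variable {k L} {A : Type*} [NonAssocRing A] [Module k A] [IsScalarTower k A A] [SMulCommClass k A A]

/-- The homomorphism of unital algebras from the free algebra that extends `f`. -/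
def freeLift (f : L → A) : FreeAlg k L →ₙₐ[k] A :=
  MonoidAlgebra.liftMagma k (WithOne.lift (FreeMagma.lift f)).toMulHom

theorem freeLift_gen (f : L → A) (x : L) : freeLift f (gen k x) = f x := by
  simp [freeLift, gen]

theorem freeLift_one (f : L → A) : freeLift (k := k) f 1 = 1 := by
  simp [freeLift, MonoidAlgebra.one_def]

end FreeLift

variable [AddCommGroup L] [Module k L] [MaltsevAlgebra k L]

/-- The defining relations of the enveloping algebra. The first two make the generators depend
linearly on the elements of `L`; the others are `xy - yx = [x,y]`, `(x,h,g) + (h,x,g) = 0` and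
`(h,x,g) + (h,g,x) = 0` for `x, y` in `L` and `h, g` in the free algebra, where
`(a,b,c) = (ab)c - a(bc)`. -/
inductive Rel : FreeAlg k L → FreeAlg k L → Prop
  | add (x y : L) : Rel (gen k (x + y)) (gen k x + gen k y)
  | smul (c : k) (x : L) : Rel (gen k (c • x)) (c • gen k x)
  | comm (x y : L) : Rel (gen k x * gen k y - gen k y * gen k x) (gen k ⁅x, y⁆)
  | left (x : L) (h g : FreeAlg k L) :
      Rel (associator (gen k x) h g + associator h (gen k x) g) 0
  | right (x : L) (h g : FreeAlg k L) :
      Rel (associator h (gen k x) g + associator h g (gen k x)) 0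

/-- The enveloping algebra `U(L)`: the quotient of the free unital nonassociative algebra by the
ideal that the relations generate. -/
def Envelope : Type _ := (ringConGen (Rel k L)).Quotient

namespace Envelope

instance : NonAssocRing (Envelope k L) := inferInstanceAs (NonAssocRing (RingCon.Quotient _))

instance : DistribMulAction k (Envelope k L) :=
  inferInstanceAs (DistribMulAction k (RingCon.Quotient _))

/-- The quotient map from the free algebra. -/
def mk : FreeAlg k L →+* Envelope k L := RingCon.mk' (ringConGen (Rel k L))

theorem mk_surjective : Function.Surjective (mk k L) :=
  RingCon.mk'_surjective (c := ringConGen (Rel k L))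

theorem mk_smul (c : k) (a : FreeAlg k L) : mk k L (c • a) = c • mk k L a := rfl

theorem mk_rel {a b : FreeAlg k L} (h : Rel k L a b) : mk k L a = mk k L b :=
  ((ringConGen (Rel k L)).eq).2 (RingConGen.Rel.of _ _ h)

instance : Module k (Envelope k L) where
  add_smul c d a := by
    obtain ⟨a, rfl⟩ := mk_surjective k L a
    rw [← mk_smul, ← mk_smul, ← mk_smul, add_smul, map_add]
  zero_smul a := by
    obtain ⟨a, rfl⟩ := mk_surjective k L a
    rw [← mk_smul, zero_smul, map_zero]

instance : IsScalarTower k (Envelope k L) (Envelope k L) :=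
  inferInstanceAs (IsScalarTower k (RingCon.Quotient _) (RingCon.Quotient _))

instance : SMulCommClass k (Envelope k L) (Envelope k L) :=
  inferInstanceAs (SMulCommClass k (RingCon.Quotient _) (RingCon.Quotient _))

/-- The canonical linear map `L → U(L)`. -/
def ι : L →ₗ[k] Envelope k L where
  toFun x := mk k L (gen k x)
  map_add' x y := by rw [mk_rel k L (.add x y), map_add]
  map_smul' c x := by rw [mk_rel k L (.smul c x), mk_smul, RingHom.id_apply]

theorem map_associator {A B : Type*} [NonAssocRing A] [NonAssocRing B] (f : A →+* B) (a b c : A) :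
    f (associator a b c) = associator (f a) (f b) (f c) := by
  simp [associator]

theorem ι_comm (x y : L) : ι k L x * ι k L y - ι k L y * ι k L x = ι k L ⁅x, y⁆ := by
  have := mk_rel k L (.comm x y)
  rwa [map_sub, map_mul, map_mul] at this

theorem ι_left (x : L) (h g : Envelope k L) :
    associator (ι k L x) h g + associator h (ι k L x) g = 0 := by
  obtain ⟨h, rfl⟩ := mk_surjective k L h
  obtain ⟨g, rfl⟩ := mk_surjective k L g
  have := mk_rel k L (.left x h g)
  rwa [map_add, map_associator, map_associator, map_zero] at this

theorem ι_right (x : L) (h g : Envelope k L) :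
    associator h (ι k L x) g + associator h g (ι k L x) = 0 := by
  obtain ⟨h, rfl⟩ := mk_surjective k L h
  obtain ⟨g, rfl⟩ := mk_surjective k L g
  have := mk_rel k L (.right x h g)
  rwa [map_add, map_associator, map_associator, map_zero] at this

variable {k L} in
/-- `U(L)` is generated by `L` as a unital algebra. -/
theorem induction {P : Envelope k L → Prop} (one : P 1) (of : ∀ x, P (ι k L x))
    (add : ∀ a b, P a → P b → P (a + b)) (smul : ∀ (c : k) a, P a → P (c • a))
    (mul : ∀ a b, P a → P b → P (a * b)) (a : Envelope k L) : P a := by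
  obtain ⟨a, rfl⟩ := mk_surjective k L a
  have word : ∀ w : WithOne (FreeMagma L), P (mk k L (MonoidAlgebra.single w 1)) := by
    intro w
    cases w with
    | one =>
      have : (MonoidAlgebra.single (1 : WithOne (FreeMagma L)) (1 : k)) = 1 := rfl
      rw [this, map_one]; exact one
    | coe w =>
      induction w with
      | ih1 x => exact of x
      | ih2 v w hv hw =>
        have h := mul _ _ hv hw
        rw [← map_mul, MonoidAlgebra.single_mul_single, one_mul] at h
        exact h
  induction a using MonoidAlgebra.induction_linear with
  | zero => rw [map_zero, ← zero_smul k (1 : Envelope k L)]; exact smul 0 1 one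
  | add a b ha hb => rw [map_add]; exact add _ _ ha hb
  | single w c =>
    have h := smul c _ (word w)
    rw [← mk_smul, MonoidAlgebra.smul_single, smul_eq_mul, mul_one] at h
    exact h

section Lift

variable {k L} {A : Type*} [NonAssocRing A] [Module k A] [IsScalarTower k A A] [SMulCommClass k A A]

/-- The universal property of `U(L)`: a linear map `f : L → A` to a unital algebra that satisfies
the defining relations extends to a homomorphism of unital algebras. -/
def lift (f : L →ₗ[k] A) (comm : ∀ x y, f x * f y - f y * f x = f ⁅x, y⁆)
    (left : ∀ x a b, associator (f x) a b + associator a (f x) b = 0)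
    (right : ∀ x a b, associator a (f x) b + associator a b (f x) = 0) :
    Envelope k L →ₙₐ[k] A :=
  let F : FreeAlg k L →+* A :=
    { toFun := freeLift f
      map_one' := freeLift_one f
      map_mul' := map_mul _
      map_zero' := map_zero _
      map_add' := map_add _ }
  have hF (x) : F (gen k x) = f x := freeLift_gen f x
  have hs (c : k) (a) : F (c • a) = c • F a := map_smul (freeLift f) c a
  have key : ringConGen (Rel k L) ≤ RingCon.ker F := by
    rw [RingCon.ringConGen_le]
    intro a b h
    change F a = F b
    cases h with
    | add x y => rw [map_add, hF, hF, hF, map_add]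
    | smul c x => rw [hs, hF, hF, map_smul]
    | comm x y => rw [map_sub, map_mul, map_mul, hF, hF, hF, comm]
    | left x h g => rw [map_add, map_associator, map_associator, hF, left, map_zero]
    | right x h g => rw [map_add, map_associator, map_associator, hF, right, map_zero]
  let G : Envelope k L →+* A := RingCon.lift _ F key
  { toFun := G
    map_smul' := fun c a => by
      obtain ⟨a, rfl⟩ := mk_surjective k L a
      exact hs c a
    map_zero' := map_zero G
    map_add' := map_add G
    map_mul' := map_mul G }

variable (f : L →ₗ[k] A) (comm : ∀ x y, f x * f y - f y * f x = f ⁅x, y⁆)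
    (left : ∀ x a b, associator (f x) a b + associator a (f x) b = 0)
    (right : ∀ x a b, associator a (f x) b + associator a b (f x) = 0)

theorem lift_ι (x : L) : lift f comm left right (ι k L x) = f x := freeLift_gen f x

theorem lift_one : lift f comm left right 1 = 1 := freeLift_one (k := k) f

end Lift

/-- The coproduct of `U(L)`: the homomorphism of unital algebras with `Δ x = x ⊗ 1 + 1 ⊗ x` for
all `x` in `L`. -/
def comulHom : Envelope k L →ₙₐ[k] Envelope k L ⊗[k] Envelope k L :=
  lift ((TensorProduct.mk k _ _).flip 1 ∘ₗ ι k L + TensorProduct.mk k _ _ 1 ∘ₗ ι k L)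
    (fun x y => by
      simp only [LinearMap.add_apply, LinearMap.comp_apply, LinearMap.flip_apply,
        TensorProduct.mk_apply, mul_add, add_mul, Algebra.TensorProduct.tmul_mul_tmul, mul_one,
        one_mul, ← ι_comm, TensorProduct.sub_tmul, TensorProduct.tmul_sub]
      abel)
    (fun x a b => by
      simp only [LinearMap.add_apply, LinearMap.comp_apply, LinearMap.flip_apply,
        TensorProduct.mk_apply]
      induction a with
      | zero => simp [associator]
      | add a a' h h' =>
        rw [← add_zero 0]
        nth_rewrite 1 [← h]
        rw [← h']
        simp only [associator, add_mul, mul_add]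
        abel
      | tmul a a' =>
        induction b with
        | zero => simp [associator]
        | add b b' h h' =>
          rw [← add_zero 0]
          nth_rewrite 1 [← h]
          rw [← h']
          simp only [associator, add_mul, mul_add]
          abel
        | tmul b b' =>
          have h₁ := congrArg (· ⊗ₜ[k] (a' * b')) (ι_left k L x a b)
          have h₂ := congrArg ((a * b) ⊗ₜ[k] ·) (ι_left k L x a' b')
          have h := congrArg₂ (· + ·) h₁ h₂
          simp only [associator, TensorProduct.add_tmul, TensorProduct.sub_tmul,
            TensorProduct.tmul_add, TensorProduct.tmul_sub, TensorProduct.zero_tmul,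
            TensorProduct.tmul_zero, add_zero] at h
          simp only [associator, add_mul, mul_add, Algebra.TensorProduct.tmul_mul_tmul, one_mul,
            mul_one]
          rw [← h]
          abel)
    (fun x a b => by
      simp only [LinearMap.add_apply, LinearMap.comp_apply, LinearMap.flip_apply,
        TensorProduct.mk_apply]
      induction a with
      | zero => simp [associator]
      | add a a' h h' =>
        rw [← add_zero 0]
        nth_rewrite 1 [← h]
        rw [← h']
        simp only [associator, add_mul, mul_add]
        abel
      | tmul a a' =>
        induction b with
        | zero => simp [associator]
        | add b b' h h' =>
          rw [← add_zero 0]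
          nth_rewrite 1 [← h]
          rw [← h']
          simp only [associator, add_mul, mul_add]
          abel
        | tmul b b' =>
          have h₁ := congrArg (· ⊗ₜ[k] (a' * b')) (ι_right k L x a b)
          have h₂ := congrArg ((a * b) ⊗ₜ[k] ·) (ι_right k L x a' b')
          have h := congrArg₂ (· + ·) h₁ h₂
          simp only [associator, TensorProduct.add_tmul, TensorProduct.sub_tmul,
            TensorProduct.tmul_add, TensorProduct.tmul_sub, TensorProduct.zero_tmul,
            TensorProduct.tmul_zero, add_zero] at h
          simp only [associator, add_mul, mul_add, Algebra.TensorProduct.tmul_mul_tmul, one_mul,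
            mul_one]
          rw [← h]
          abel)

theorem comulHom_ι (x : L) : comulHom k L (ι k L x) = ι k L x ⊗ₜ 1 + 1 ⊗ₜ ι k L x := by
  simp [comulHom, lift_ι]

theorem comulHom_one : comulHom k L 1 = 1 := lift_one ..

/-- The counit of `U(L)`: the homomorphism of unital algebras with `ε x = 0` for all `x` in `L`. -/
def counitHom : Envelope k L →ₙₐ[k] k :=
  lift 0 (by simp) (by simp [associator]) (by simp [associator])

theorem counitHom_ι (x : L) : counitHom k L (ι k L x) = 0 := by simp [counitHom, lift_ι]

theorem counitHom_one : counitHom k L 1 = 1 := lift_one ..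

/-- The antipode of `U(L)` as a homomorphism to the opposite algebra. -/
def antipodeHom : Envelope k L →ₙₐ[k] (Envelope k L)ᵐᵒᵖ :=
  lift (-((MulOpposite.opLinearEquiv k).toLinearMap ∘ₗ ι k L))
    (fun x y => by
      apply MulOpposite.unop_injective
      simp [← ι_comm])
    (fun x a b => by
      have h := ι_right k L x b.unop a.unop
      simp only [associator] at h
      apply MulOpposite.unop_injective
      simp only [associator, LinearMap.neg_apply, LinearMap.comp_apply, LinearEquiv.coe_coe,
        MulOpposite.coe_opLinearEquiv, MulOpposite.unop_add, MulOpposite.unop_sub,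
        MulOpposite.unop_mul, MulOpposite.unop_neg, MulOpposite.unop_op, MulOpposite.unop_zero,
        neg_mul, mul_neg]
      rw [← h]
      abel)
    (fun x a b => by
      have h := ι_left k L x b.unop a.unop
      simp only [associator] at h
      apply MulOpposite.unop_injective
      simp only [associator, LinearMap.neg_apply, LinearMap.comp_apply, LinearEquiv.coe_coe,
        MulOpposite.coe_opLinearEquiv, MulOpposite.unop_add, MulOpposite.unop_sub,
        MulOpposite.unop_mul, MulOpposite.unop_neg, MulOpposite.unop_op, MulOpposite.unop_zero,
        neg_mul, mul_neg]
      rw [← h]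
      abel)

/-- The antipode of `U(L)`: the linear antihomomorphism of unital algebras with `S x = -x` for all
`x` in `L`. -/
def antipode : Envelope k L →ₗ[k] Envelope k L :=
  (MulOpposite.opLinearEquiv k).symm.toLinearMap ∘ₗ (antipodeHom k L : _ →ₗ[k] _)

theorem antipode_ι (x : L) : antipode k L (ι k L x) = -ι k L x := by
  simp [antipode, antipodeHom, lift_ι]

theorem antipode_one : antipode k L 1 = 1 := by
  simp [antipode, antipodeHom, lift_one]

theorem antipode_mul (a b : Envelope k L) :
    antipode k L (a * b) = antipode k L b * antipode k L a := by
  simp [antipode]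

section TensorMul

variable {k} {A B C : Type*} [NonAssocRing A] [Module k A] [IsScalarTower k A A]
  [SMulCommClass k A A] [NonAssocRing B] [Module k B] [IsScalarTower k B B] [SMulCommClass k B B]
  [NonAssocRing C] [Module k C] [IsScalarTower k C C] [SMulCommClass k C C]

theorem rTensor_mul (f : A →ₗ[k] B) (hf : ∀ x y, f (x * y) = f x * f y) (a b : A ⊗[k] C) :
    f.rTensor C (a * b) = f.rTensor C a * f.rTensor C b := by
  induction a with
  | zero => simp
  | add a a' h h' => simp only [add_mul, map_add, h, h']
  | tmul a a' =>
    induction b with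
    | zero => simp
    | add b b' h h' => simp only [mul_add, map_add, h, h']
    | tmul b b' => simp [hf]

theorem lTensor_mul (f : A →ₗ[k] B) (hf : ∀ x y, f (x * y) = f x * f y) (a b : C ⊗[k] A) :
    f.lTensor C (a * b) = f.lTensor C a * f.lTensor C b := by
  induction a with
  | zero => simp
  | add a a' h h' => simp only [add_mul, map_add, h, h']
  | tmul a a' =>
    induction b with
    | zero => simp
    | add b b' h h' => simp only [mul_add, map_add, h, h']
    | tmul b b' => simp [hf]

theorem assoc_mul (a b : (A ⊗[k] B) ⊗[k] C) :
    TensorProduct.assoc k A B C (a * b) =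
      TensorProduct.assoc k A B C a * TensorProduct.assoc k A B C b := by
  induction a with
  | zero => simp
  | add a a' h h' => simp only [add_mul, map_add, h, h']
  | tmul a a' =>
    induction b with
    | zero => simp
    | add b b' h h' => simp only [mul_add, map_add, h, h']
    | tmul b b' =>
      induction a with
      | zero => simp
      | add a a' h h' => simp only [TensorProduct.add_tmul, add_mul, map_add, h, h']
      | tmul a a' =>
        induction b with
        | zero => simp
        | add b b' h h' => simp only [TensorProduct.add_tmul, mul_add, map_add, h, h']
        | tmul b b' => simp

end TensorMul

theorem comulHom_mul (a b : Envelope k L) :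
    (comulHom k L : _ →ₗ[k] Envelope k L ⊗[k] Envelope k L) (a * b) =
      (comulHom k L : _ →ₗ[k] Envelope k L ⊗[k] Envelope k L) a * (comulHom k L : _ →ₗ[k] Envelope k L ⊗[k] Envelope k L) b :=
  map_mul (comulHom k L) a b

theorem counitHom_mul (a b : Envelope k L) :
    (counitHom k L : _ →ₗ[k] k) (a * b) =
      (counitHom k L : _ →ₗ[k] k) a * (counitHom k L : _ →ₗ[k] k) b :=
  map_mul (counitHom k L) a b

instance : Coalgebra k (Envelope k L) where
  comul := comulHom k L
  counit := counitHom k L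
  coassoc := by
    ext a
    simp only [LinearMap.comp_apply, LinearEquiv.coe_coe]
    induction a using induction with
    | one => simp [comulHom_one, Algebra.TensorProduct.one_def]
    | of x =>
      simp [comulHom_ι, comulHom_one, Algebra.TensorProduct.one_def, TensorProduct.add_tmul,
        TensorProduct.tmul_add, add_assoc]
    | add a b h h' => simp only [map_add, h, h']
    | smul c a h => simp only [map_smul, h]
    | mul a b h h' =>
      rw [comulHom_mul, rTensor_mul _ (comulHom_mul k L), assoc_mul, h, h',
        lTensor_mul _ (comulHom_mul k L)]
  rTensor_counit_comp_comul := by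
    ext a
    simp only [LinearMap.comp_apply]
    induction a using induction with
    | one => simp [comulHom_one, counitHom_one, Algebra.TensorProduct.one_def]
    | of x => simp [comulHom_ι, counitHom_one, counitHom_ι]
    | add a b h h' => simp only [map_add, h, h']
    | smul c a h => simp only [map_smul, h]
    | mul a b h h' =>
      rw [comulHom_mul, rTensor_mul _ (counitHom_mul k L), h, h']
      simp
  lTensor_counit_comp_comul := by
    ext a
    simp only [LinearMap.comp_apply]
    induction a using induction with
    | one => simp [comulHom_one, counitHom_one, Algebra.TensorProduct.one_def]
    | of x => simp [comulHom_ι, counitHom_one, counitHom_ι]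
    | add a b h h' => simp only [map_add, h, h']
    | smul c a h => simp only [map_smul, h]
    | mul a b h h' =>
      rw [comulHom_mul, lTensor_mul _ (counitHom_mul k L), h, h']
      simp

theorem comul_ι (x : L) : Coalgebra.comul (R := k) (ι k L x) = ι k L x ⊗ₜ 1 + 1 ⊗ₜ ι k L x :=
  comulHom_ι k L x

theorem counit_ι (x : L) : Coalgebra.counit (R := k) (ι k L x) = 0 :=
  counitHom_ι k L x

end Envelope

end

end MaltsevAlgebra

/-! Elements of `L` are primitive and lie in the generalized alternative nucleus of `U(L)`. The
alternative nucleus relations rewrite left multiplication by a product `xa` or `ax`, with `x` in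
`L`, in terms of one-sided multiplications by `x` and `a`; hence `U(L)` is spanned by the words
`T₁ ⋯ Tₙ 1`, where each `Tᵢ` is a left or right multiplication by an element of `L`. By induction
along such words, every `h` has an operator `U` such that `h₁(g(h₂ f)) = U(g) f` and
`(h₁ y)(z h₂) = U(y z)`, because these two identities for `a` pass to `xa` and `ax`. Eliminating `U`
gives the Moufang identity.

The same induction shows `S(h₁)(h₂ g) = ε(h) g`, that `U(L)` is cocommutative, and that `S` is an
involution commuting with `Δ`; the other three antipode identities follow by applying `S`. -/

/-- `x` lies in the generalized alternative nucleus: `(x,a,b) = -(a,x,b) = (a,b,x)` for all `a`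
and `b`, written with sums as in the relations of `U(L)`. -/
structure IsAltNuclear {A : Type*} [NonUnitalNonAssocRing A] (x : A) : Prop where
  left : ∀ a b, associator x a b + associator a x b = 0
  right : ∀ a b, associator a x b + associator a b x = 0

namespace IsAltNuclear

section NonUnital

variable {A : Type*} [NonUnitalNonAssocRing A] {x : A}

theorem mul_assoc_left (hx : IsAltNuclear x) (a b : A) :
    (x * a) * b = x * (a * b) + (a * b) * x - a * (b * x) := by
  have h := congrArg₂ (· - ·) (hx.left a b) (hx.right a b)
  simp only [associator, sub_zero] at h
  rw [← sub_eq_zero, ← h]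
  abel

theorem mul_assoc_middle (hx : IsAltNuclear x) (a b : A) :
    (a * x) * b = a * (x * b) + a * (b * x) - (a * b) * x := by
  have h := hx.right a b
  simp only [associator] at h
  rw [← sub_eq_zero, ← h]
  abel

theorem mul_assoc_symm_middle (hx : IsAltNuclear x) (a b : A) :
    a * (x * b) = (a * x) * b + (x * a) * b - x * (a * b) := by
  have h := hx.left a b
  simp only [associator] at h
  rw [eq_comm, ← sub_eq_zero, ← h]
  abel

theorem mul_assoc_symm_right (hx : IsAltNuclear x) (a b : A) :
    a * (b * x) = x * (a * b) + (a * b) * x - (x * a) * b := by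
  rw [hx.mul_assoc_left]
  abel

end NonUnital

theorem adjoin_induction {k A : Type*} [CommRing k] [NonAssocRing A] [Module k A]
    [IsScalarTower k A A] [SMulCommClass k A A] {s : Set A} (hs : ∀ x ∈ s, IsAltNuclear x)
    {P : A → Prop} (one : P 1) (add : ∀ a b, P a → P b → P (a + b))
    (smul : ∀ (c : k) a, P a → P (c • a)) (self_mul : ∀ x ∈ s, ∀ a, P a → P (x * a))
    (mul_self : ∀ x ∈ s, ∀ a, P a → P (a * x)) {a : A}
    (ha : a ∈ NonUnitalAlgebra.adjoin k (insert 1 s)) : P a := by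
  have sub {P : A → Prop} (add : ∀ a b, P a → P b → P (a + b))
      (smul : ∀ (c : k) a, P a → P (c • a)) (a b) (ha : P a) (hb : P b) : P (a - b) := by
    rw [sub_eq_add_neg, ← neg_one_smul k b]
    exact add _ _ ha (smul _ _ hb)
  induction ha using NonUnitalAlgebra.adjoin_induction generalizing P with
  | mem x hx =>
    obtain rfl | hx := hx
    · exact one
    · simpa using self_mul x hx 1 one
  | add a b _ _ iha ihb =>
    exact add a b (iha one add smul self_mul mul_self) (ihb one add smul self_mul mul_self)
  | zero => simpa using smul 0 1 one
  | smul c a _ iha => exact smul c a (iha one add smul self_mul mul_self)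
  | mul _ b _ _ iha ihb =>
    -- The predicate `∀ c, P c → P (a * c)` on `a` inherits all closure properties of `P`.
    refine iha (P := fun a ↦ ∀ c, P c → P (a * c)) (fun c hc ↦ by rwa [one_mul])
      (fun a b ha hb c hc ↦ by rw [add_mul]; exact add _ _ (ha c hc) (hb c hc))
      (fun r a ha c hc ↦ by rw [smul_mul_assoc]; exact smul r _ (ha c hc))
      (fun x hx a ha c hc ↦ ?_) (fun x hx a ha c hc ↦ ?_) b
      (ihb one add smul self_mul mul_self)
    · rw [(hs x hx).mul_assoc_left]
      exact sub add smul _ _ (add _ _ (self_mul x hx _ (ha c hc)) (mul_self x hx _ (ha c hc)))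
        (ha _ (mul_self x hx c hc))
    · rw [(hs x hx).mul_assoc_middle]
      exact sub add smul _ _ (add _ _ (ha _ (self_mul x hx c hc)) (ha _ (mul_self x hx c hc)))
        (mul_self x hx _ (ha c hc))

end IsAltNuclear

open Coalgebra LinearMap

section MulMap

variable {k H : Type*} [CommRing k] [NonAssocRing H] [Module k H] [IsScalarTower k H H]
  [SMulCommClass k H H]

/-- The linear map `a ⊗ b ↦ p(a) q(b)`, whose value at `Δ h` is `p(h₁) q(h₂)`. -/
def mulMap (p q : H →ₗ[k] H) : H ⊗[k] H →ₗ[k] H := mul' k H ∘ₗ TensorProduct.map p q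

@[simp]
theorem mulMap_tmul (p q : H →ₗ[k] H) (a b : H) : mulMap p q (a ⊗ₜ b) = p a * q b := rfl

theorem mulMap_mulRight_comp (p q : H →ₗ[k] H) (t : H ⊗[k] H) (g : H) :
    mulMap p (mulRight k g ∘ₗ q) t = mul' k H (lTensor H (mul' k H)
      (TensorProduct.map p (TensorProduct.map q id) (TensorProduct.assoc k H H H (t ⊗ₜ g)))) := by
  induction t with
  | zero => simp
  | add t u ht hu => simp only [TensorProduct.add_tmul, map_add, ht, hu]
  | tmul a b => simp

theorem mulMap_mulLeft_comp (p q : H →ₗ[k] H) (h : H) (t : H ⊗[k] H) :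
    mulMap (mulLeft k h ∘ₗ p) q t = mul' k H (rTensor H (mul' k H)
      (TensorProduct.map (TensorProduct.map id p) q
        ((TensorProduct.assoc k H H H).symm (h ⊗ₜ t)))) := by
  induction t with
  | zero => simp
  | add t u ht hu => simp only [TensorProduct.tmul_add, map_add, ht, hu]
  | tmul a b => simp

end MulMap

section Bialgebra

variable (k : Type*) {H : Type*} [CommRing k] [NonAssocRing H] [Module k H] [IsScalarTower k H H]
  [SMulCommClass k H H] [Coalgebra k H]

/-- The compatibility axioms of a bialgebra, for a unital algebra `H` that need not be
associative (so that Mathlib's `Bialgebra` does not apply). -/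
structure IsNonassocBialgebra (H : Type*) [NonAssocRing H] [Module k H] [IsScalarTower k H H]
    [SMulCommClass k H H] [Coalgebra k H] : Prop where
  comul_one : comul (R := k) (1 : H) = 1
  comul_mul : ∀ h g : H, comul (R := k) (h * g) = comul (R := k) h * comul (R := k) g
  counit_one : counit (R := k) (1 : H) = 1
  counit_mul : ∀ h g : H, counit (R := k) (h * g) = counit (R := k) h * counit (R := k) g

/-- `x` is a primitive element of a unital algebra with a coproduct. -/
structure IsPrimitive (x : H) : Prop where
  comul_eq : comul (R := k) x = x ⊗ₜ 1 + 1 ⊗ₜ x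

/-- `s` generates `H` as a unital algebra, by primitive elements that lie in the generalized
alternative nucleus. This is how `L` sits inside `U(L)`. -/
structure IsAltPrimitiveGenerating (s : Set H) : Prop where
  isAltNuclear : ∀ x ∈ s, IsAltNuclear x
  isPrimitive : ∀ x ∈ s, IsPrimitive k x
  adjoin_eq_top : NonUnitalAlgebra.adjoin k (insert 1 s) = ⊤

/-- `S` is the principal antihomomorphism for the generating set `s`: the antihomomorphism of
unital algebras that is `-1` on `s`. -/
structure IsPrincipalAntihom (s : Set H) (S : H →ₗ[k] H) : Prop where
  map_one : S 1 = 1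
  map_mul : ∀ a b, S (a * b) = S b * S a
  map_generator : ∀ x ∈ s, S x = -x

variable {k} {s : Set H} {S : H →ₗ[k] H} {x : H}

theorem IsAltPrimitiveGenerating.induction (hs : IsAltPrimitiveGenerating k s) {P : H → Prop}
    (one : P 1) (add : ∀ a b, P a → P b → P (a + b)) (smul : ∀ (c : k) a, P a → P (c • a))
    (self_mul : ∀ x ∈ s, ∀ a, P a → P (x * a)) (mul_self : ∀ x ∈ s, ∀ a, P a → P (a * x))
    (a : H) : P a :=
  IsAltNuclear.adjoin_induction hs.isAltNuclear one add smul self_mul mul_self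
    (hs.adjoin_eq_top ▸ NonUnitalAlgebra.mem_top)

namespace IsPrimitive

section Map

variable {M : Type*} [AddCommGroup M] [Module k M] {Φ Ψ : H ⊗[k] H →ₗ[k] M}

theorem map_comul_self_mul (hx : IsPrimitive k x) (hH : IsNonassocBialgebra k H)
    (h : ∀ a b, Φ ((x * a) ⊗ₜ b) + Φ (a ⊗ₜ (x * b)) = Ψ (a ⊗ₜ b)) (a : H) :
    Φ (comul (x * a)) = Ψ (comul a) := by
  rw [hH.comul_mul, hx.comul_eq]
  induction comul (R := k) a with
  | zero => simp
  | add t u ht hu => rw [mul_add, map_add, map_add, ht, hu]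
  | tmul a b => simpa [add_mul] using h a b

theorem map_comul_mul_self (hx : IsPrimitive k x) (hH : IsNonassocBialgebra k H)
    (h : ∀ a b, Φ ((a * x) ⊗ₜ b) + Φ (a ⊗ₜ (b * x)) = Ψ (a ⊗ₜ b)) (a : H) :
    Φ (comul (a * x)) = Ψ (comul a) := by
  rw [hH.comul_mul, hx.comul_eq]
  induction comul (R := k) a with
  | zero => simp
  | add t u ht hu => rw [add_mul, map_add, map_add, ht, hu]
  | tmul a b => simpa [mul_add] using h a b

end Map

theorem counit_eq_zero (hx : IsPrimitive k x) (hH : IsNonassocBialgebra k H) :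
    counit (R := k) x = 0 := by
  have h := congrArg (TensorProduct.lid k H) (rTensor_counit_comul (R := k) x)
  rw [hx.comul_eq] at h
  have h : counit (R := k) x • (1 : H) = 0 := by simpa [hH.counit_one] using h
  simpa [hH.counit_one] using congrArg (counit (R := k)) h

end IsPrimitive

/-- `U` is the operator `g ↦ (h₁ g) h₂` of `h`, and satisfies the left and middle Moufang identities
`h₁(g(h₂ f)) = U(g) f` and `(h₁ y)(z h₂) = U(y z)`. The second determines `U` (take `z = 1`). -/
structure IsUOperator (h : H) (U : H →ₗ[k] H) : Prop where
  left_moufang : ∀ g f, mulMap id (mulLeft k g ∘ₗ mulRight k f) (comul h) = U g * f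
  middle_moufang : ∀ y z, mulMap (mulRight k y) (mulLeft k z) (comul h) = U (y * z)

namespace IsUOperator

variable {a b : H} {U V : H →ₗ[k] H}

theorem one (hH : IsNonassocBialgebra k H) : IsUOperator (1 : H) (id : H →ₗ[k] H) where
  left_moufang g f := by simp [hH.comul_one, Algebra.TensorProduct.one_def]
  middle_moufang y z := by simp [hH.comul_one, Algebra.TensorProduct.one_def]

theorem add (hU : IsUOperator a U) (hV : IsUOperator b V) : IsUOperator (a + b) (U + V) where
  left_moufang g f := by simp [hU.left_moufang, hV.left_moufang, add_mul]
  middle_moufang y z := by simp [hU.middle_moufang, hV.middle_moufang]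

theorem smul (c : k) (hU : IsUOperator a U) : IsUOperator (c • a) (c • U) where
  left_moufang g f := by simp [hU.left_moufang, smul_mul_assoc]
  middle_moufang y z := by simp [hU.middle_moufang]

theorem self_mul (hU : IsUOperator a U) (hH : IsNonassocBialgebra k H) (hx : IsPrimitive k x)
    (hx' : IsAltNuclear x) : IsUOperator (x * a) (mulLeft k x ∘ₗ U + U ∘ₗ mulRight k x) where
  left_moufang g f := by
    let Φ (g f : H) := mulMap id (mulLeft k g ∘ₗ mulRight k f)
    rw [hx.map_comul_self_mul hH (Φ := Φ g f)
      (Ψ := mulLeft k x ∘ₗ Φ g f + mulRight k x ∘ₗ Φ g f - Φ g (f * x) + Φ (g * x) f)]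
    · simp only [Φ, LinearMap.add_apply, LinearMap.sub_apply, comp_apply, mulLeft_apply,
        mulRight_apply, hU.left_moufang, add_mul]
      rw [hx'.mul_assoc_left (U g)]
    · intro a b
      simp only [Φ, LinearMap.add_apply, LinearMap.sub_apply, comp_apply, mulMap_tmul, id_apply,
        mulLeft_apply, mulRight_apply]
      rw [hx'.mul_assoc_left a, hx'.mul_assoc_left b, hx'.mul_assoc_middle g]
      simp only [mul_add, mul_sub]
      abel
  middle_moufang y z := by
    let Φ (y z : H) := mulMap (mulRight k y) (mulLeft k z)
    rw [hx.map_comul_self_mul hH (Φ := Φ y z)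
      (Ψ := mulLeft k x ∘ₗ Φ y z - Φ (y * x) z + Φ y (z * x) + Φ y (x * z))]
    · simp only [Φ, LinearMap.add_apply, LinearMap.sub_apply, comp_apply, mulLeft_apply,
        mulRight_apply, hU.middle_moufang]
      rw [hx'.mul_assoc_middle y, map_sub, map_add]
      abel
    · intro a b
      simp only [Φ, LinearMap.add_apply, LinearMap.sub_apply, comp_apply, mulMap_tmul,
        mulLeft_apply, mulRight_apply]
      rw [hx'.mul_assoc_left a, hx'.mul_assoc_symm_middle z]
      simp only [mul_add, mul_sub, add_mul, sub_mul]
      rw [hx'.mul_assoc_symm_middle (a * y)]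
      abel

theorem mul_self (hU : IsUOperator a U) (hH : IsNonassocBialgebra k H) (hx : IsPrimitive k x)
    (hx' : IsAltNuclear x) : IsUOperator (a * x) (mulRight k x ∘ₗ U + U ∘ₗ mulLeft k x) where
  left_moufang g f := by
    let Φ (g f : H) := mulMap id (mulLeft k g ∘ₗ mulRight k f)
    rw [hx.map_comul_mul_self hH (Φ := Φ g f)
      (Ψ := Φ g (x * f) + Φ g (f * x) - mulRight k x ∘ₗ Φ g f + Φ (x * g) f)]
    · simp only [Φ, LinearMap.add_apply, LinearMap.sub_apply, comp_apply, mulLeft_apply,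
        mulRight_apply, hU.left_moufang, add_mul]
      rw [hx'.mul_assoc_middle (U g)]
    · intro a b
      simp only [Φ, LinearMap.add_apply, LinearMap.sub_apply, comp_apply, mulMap_tmul, id_apply,
        mulLeft_apply, mulRight_apply]
      rw [hx'.mul_assoc_middle a, hx'.mul_assoc_middle b]
      simp only [mul_add, mul_sub]
      rw [hx'.mul_assoc_symm_right g (b * f)]
      simp only [mul_add, mul_sub]
      abel
  middle_moufang y z := by
    let Φ (y z : H) := mulMap (mulRight k y) (mulLeft k z)
    rw [hx.map_comul_mul_self hH (Φ := Φ y z)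
      (Ψ := Φ (x * y) z + Φ (y * x) z - Φ y (x * z) + mulRight k x ∘ₗ Φ y z)]
    · simp only [Φ, LinearMap.add_apply, LinearMap.sub_apply, comp_apply, mulLeft_apply,
        mulRight_apply, hU.middle_moufang]
      have h := congrArg U (hx'.mul_assoc_symm_middle y z)
      rw [map_sub, map_add] at h
      rw [h]
      abel
    · intro a b
      simp only [Φ, LinearMap.add_apply, LinearMap.sub_apply, comp_apply, mulMap_tmul,
        mulLeft_apply, mulRight_apply]
      rw [hx'.mul_assoc_middle a, hx'.mul_assoc_symm_right z]
      simp only [mul_add, mul_sub, add_mul, sub_mul]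
      rw [hx'.mul_assoc_middle (a * y)]
      abel

end IsUOperator

namespace IsAltPrimitiveGenerating

theorem exists_isUOperator (hs : IsAltPrimitiveGenerating k s) (hH : IsNonassocBialgebra k H)
    (h : H) : ∃ U : H →ₗ[k] H, IsUOperator h U := by
  induction h using hs.induction with
  | one => exact ⟨id, .one hH⟩
  | add a b ha hb =>
    obtain ⟨U, hU⟩ := ha
    obtain ⟨V, hV⟩ := hb
    exact ⟨U + V, hU.add hV⟩
  | smul c a ha =>
    obtain ⟨U, hU⟩ := ha
    exact ⟨c • U, hU.smul c⟩
  | self_mul x hx a ha =>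
    obtain ⟨U, hU⟩ := ha
    exact ⟨_, hU.self_mul hH (hs.isPrimitive x hx) (hs.isAltNuclear x hx)⟩
  | mul_self x hx a ha =>
    obtain ⟨U, hU⟩ := ha
    exact ⟨_, hU.mul_self hH (hs.isPrimitive x hx) (hs.isAltNuclear x hx)⟩

theorem isMoufang (hs : IsAltPrimitiveGenerating k s) (hH : IsNonassocBialgebra k H) :
    IsMoufang k H := by
  intro h g f n a b hab
  obtain ⟨U, hU⟩ := hs.exists_isUOperator hH h
  have left := hU.left_moufang g f
  have middle := hU.middle_moufang g 1
  rw [mul_one] at middle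
  rw [← middle, hab] at left
  simpa [Finset.sum_mul] using left

theorem isCocomm (hs : IsAltPrimitiveGenerating k s) (hH : IsNonassocBialgebra k H) :
    IsCocomm k H where
  comm_comp_comul := by
    ext h
    induction h using hs.induction with
    | one => simp [hH.comul_one, Algebra.TensorProduct.one_def]
    | add a b ha hb => rw [map_add, map_add, ha, hb]
    | smul c a ha => rw [map_smul, map_smul, ha]
    | self_mul x hx a ha =>
      rw [hH.comul_mul x a, ← ha]
      refine (hs.isPrimitive x hx).map_comul_self_mul hH
        (Φ := (TensorProduct.comm k H H).toLinearMap)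
        (Ψ := mulLeft k (comul x) ∘ₗ (TensorProduct.comm k H H).toLinearMap) (fun a b ↦ ?_) a
      simp [(hs.isPrimitive x hx).comul_eq, add_mul, add_comm]
    | mul_self x hx a ha =>
      rw [hH.comul_mul a x, ← ha]
      refine (hs.isPrimitive x hx).map_comul_mul_self hH
        (Φ := (TensorProduct.comm k H H).toLinearMap)
        (Ψ := mulRight k (comul x) ∘ₗ (TensorProduct.comm k H H).toLinearMap) (fun a b ↦ ?_) a
      simp [(hs.isPrimitive x hx).comul_eq, mul_add, add_comm]

theorem mulMap_comul_eq_map (hs : IsAltPrimitiveGenerating k s) (hH : IsNonassocBialgebra k H)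
    {p q p' q' : H →ₗ[k] H}
    (h : ∀ a b, p a * q b = S (p' b * q' a)) (a : H) :
    mulMap p q (comul a) = S (mulMap p' q' (comul a)) := by
  have := hs.isCocomm hH
  have key : mulMap p q = S ∘ₗ mulMap p' q' ∘ₗ (TensorProduct.comm k H H).toLinearMap :=
    TensorProduct.ext' h
  simp [key]

end IsAltPrimitiveGenerating

namespace IsPrincipalAntihom

theorem involutive (hS : IsPrincipalAntihom k s S) (hs : IsAltPrimitiveGenerating k s) :
    Function.Involutive S := by
  intro h
  induction h using hs.induction with
  | one => simp [hS.map_one]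
  | add a b ha hb => rw [map_add, map_add, ha, hb]
  | smul c a ha => rw [map_smul, map_smul, ha]
  | self_mul x hx a ha =>
    simp [hS.map_mul, hS.map_generator x hx, ha]
  | mul_self x hx a ha =>
    simp [hS.map_mul, hS.map_generator x hx, ha]

theorem comul_map (hS : IsPrincipalAntihom k s S) (hs : IsAltPrimitiveGenerating k s)
    (hH : IsNonassocBialgebra k H) (h : H) :
    comul (R := k) (S h) = TensorProduct.map S S (comul h) := by
  induction h using hs.induction with
  | one => simp [hS.map_one, hH.comul_one, Algebra.TensorProduct.one_def]
  | add a b ha hb => simp only [map_add, ha, hb]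
  | smul c a ha => simp only [map_smul, ha]
  | self_mul x hx a ha =>
    rw [hS.map_mul, hS.map_generator x hx, hH.comul_mul, ha]
    refine ((hs.isPrimitive x hx).map_comul_self_mul hH (Φ := TensorProduct.map S S)
      (Ψ := mulRight k (comul (-x)) ∘ₗ TensorProduct.map S S) (fun a b ↦ ?_) a).symm
    simp [hS.map_mul, hS.map_generator x hx, (hs.isPrimitive x hx).comul_eq, mul_add,
      TensorProduct.tmul_neg, TensorProduct.neg_tmul, add_comm]
  | mul_self x hx a ha =>
    rw [hS.map_mul, hS.map_generator x hx, hH.comul_mul, ha]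
    refine ((hs.isPrimitive x hx).map_comul_mul_self hH (Φ := TensorProduct.map S S)
      (Ψ := mulLeft k (comul (-x)) ∘ₗ TensorProduct.map S S) (fun a b ↦ ?_) a).symm
    simp [hS.map_mul, hS.map_generator x hx, (hs.isPrimitive x hx).comul_eq, add_mul,
      TensorProduct.tmul_neg, TensorProduct.neg_tmul, add_comm]

theorem counit_map (hS : IsPrincipalAntihom k s S) (hs : IsAltPrimitiveGenerating k s)
    (hH : IsNonassocBialgebra k H) (h : H) : counit (R := k) (S h) = counit h := by
  induction h using hs.induction with
  | one => rw [hS.map_one]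
  | add a b ha hb => simp only [map_add, ha, hb]
  | smul c a ha => simp only [map_smul, ha]
  | self_mul x hx a _ =>
    simp [hS.map_mul, hS.map_generator x hx, hH.counit_mul,
      (hs.isPrimitive x hx).counit_eq_zero hH]
  | mul_self x hx a _ =>
    simp [hS.map_mul, hS.map_generator x hx, hH.counit_mul,
      (hs.isPrimitive x hx).counit_eq_zero hH]

theorem antipode_mul_left (hS : IsPrincipalAntihom k s S) (hs : IsAltPrimitiveGenerating k s)
    (hH : IsNonassocBialgebra k H) (h g : H) :
    mulMap S (mulRight k g) (comul h) = counit (R := k) h • g := by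
  let Φ (g : H) := mulMap S (mulRight k g)
  induction h using hs.induction generalizing g with
  | one => simp [hH.comul_one, hH.counit_one, hS.map_one, Algebra.TensorProduct.one_def]
  | add a b ha hb => simp only [map_add, ha, hb, add_smul]
  | smul c a ha => simp only [map_smul, ha, smul_assoc]
  | self_mul x hx a ha =>
    have hx' := hs.isAltNuclear x hx
    rw [(hs.isPrimitive x hx).map_comul_self_mul hH (Φ := Φ g)
      (Ψ := mulRight k x ∘ₗ Φ g - Φ (g * x))]
    · simp [Φ, ha, hH.counit_mul, (hs.isPrimitive x hx).counit_eq_zero hH]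
    · intro a b
      simp only [Φ, LinearMap.sub_apply, comp_apply, mulMap_tmul, mulRight_apply, hS.map_mul,
        hS.map_generator x hx, mul_neg, neg_mul]
      rw [hx'.mul_assoc_left b, hx'.mul_assoc_middle (S a)]
      simp only [mul_add, mul_sub]
      abel
  | mul_self x hx a ha =>
    have hx' := hs.isAltNuclear x hx
    rw [(hs.isPrimitive x hx).map_comul_mul_self hH (Φ := Φ g)
      (Ψ := Φ (x * g) + Φ (g * x) - mulLeft k x ∘ₗ Φ g - mulRight k x ∘ₗ Φ g)]
    · simp [Φ, ha, hH.counit_mul, (hs.isPrimitive x hx).counit_eq_zero hH]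
    · intro a b
      simp only [Φ, LinearMap.add_apply, LinearMap.sub_apply, comp_apply, mulMap_tmul,
        mulLeft_apply, mulRight_apply, hS.map_mul, hS.map_generator x hx, neg_mul]
      rw [hx'.mul_assoc_left (S a), hx'.mul_assoc_middle b]
      simp only [mul_add, mul_sub]
      abel

theorem mul_antipode_left (hS : IsPrincipalAntihom k s S) (hs : IsAltPrimitiveGenerating k s)
    (hH : IsNonassocBialgebra k H) (h g : H) :
    mulMap id (mulRight k g ∘ₗ S) (comul h) = counit (R := k) h • g :=
  calc
    mulMap id (mulRight k g ∘ₗ S) (comul h)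
    _ = mulMap S (mulRight k g) (comul (S h)) := by
      have hSS : S ∘ₗ S = LinearMap.id := LinearMap.ext (hS.involutive hs)
      rw [hS.comul_map hs hH, mulMap, mulMap, comp_apply, comp_apply, TensorProduct.map_map, hSS]
    _ = counit (R := k) h • g := by rw [hS.antipode_mul_left hs hH, hS.counit_map hs hH]

theorem antipode_mul_right (hS : IsPrincipalAntihom k s S) (hs : IsAltPrimitiveGenerating k s)
    (hH : IsNonassocBialgebra k H) (h g : H) :
    mulMap (mulLeft k h ∘ₗ S) id (comul g) = counit (R := k) g • h := by
  have hSS (a : H) : S (S a) = a := hS.involutive hs a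
  rw [hs.mulMap_comul_eq_map hH (p' := S) (q' := mulRight k (S h)) (S := S),
    hS.antipode_mul_left hs hH, map_smul, hSS]
  simp [hS.map_mul, hSS]

theorem mul_antipode_right (hS : IsPrincipalAntihom k s S) (hs : IsAltPrimitiveGenerating k s)
    (hH : IsNonassocBialgebra k H) (h g : H) :
    mulMap (mulLeft k h) S (comul g) = counit (R := k) g • h := by
  have hSS (a : H) : S (S a) = a := hS.involutive hs a
  rw [hs.mulMap_comul_eq_map hH (p' := id) (q' := mulRight k (S h) ∘ₗ S) (S := S),
    hS.mul_antipode_left hs hH, map_smul, hSS]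
  simp [hS.map_mul, hSS]

theorem isHopfQuasigroup (hS : IsPrincipalAntihom k s S) (hs : IsAltPrimitiveGenerating k s)
    (hH : IsNonassocBialgebra k H) : IsHopfQuasigroup k H S where
  __ := hH
  antipode_mul_left := TensorProduct.ext' fun h g ↦
    (mulMap_mulRight_comp S id (comul h) g).symm.trans (hS.antipode_mul_left hs hH h g)
  mul_antipode_left := TensorProduct.ext' fun h g ↦
    (mulMap_mulRight_comp id S (comul h) g).symm.trans (hS.mul_antipode_left hs hH h g)
  antipode_mul_right := TensorProduct.ext' fun h g ↦
    (mulMap_mulLeft_comp S id h (comul g)).symm.trans (hS.antipode_mul_right hs hH h g)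
  mul_antipode_right := TensorProduct.ext' fun h g ↦
    (mulMap_mulLeft_comp id S h (comul g)).symm.trans (hS.mul_antipode_right hs hH h g)

end IsPrincipalAntihom

end Bialgebra

namespace MaltsevAlgebra.Envelope

variable (k L : Type*) [CommRing k] [AddCommGroup L] [Module k L] [MaltsevAlgebra k L]

theorem isNonassocBialgebra : IsNonassocBialgebra k (Envelope k L) where
  comul_one := comulHom_one k L
  comul_mul := comulHom_mul k L
  counit_one := counitHom_one k L
  counit_mul := counitHom_mul k L

theorem isAltPrimitiveGenerating_range_ι :
    IsAltPrimitiveGenerating k (Set.range (ι k L)) where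
  isAltNuclear := by
    rintro _ ⟨x, rfl⟩
    exact ⟨ι_left k L x, ι_right k L x⟩
  isPrimitive := by
    rintro _ ⟨x, rfl⟩
    exact ⟨comul_ι k L x⟩
  adjoin_eq_top := by
    refine NonUnitalAlgebra.eq_top_iff.2 fun a ↦ ?_
    induction a using induction with
    | one => exact NonUnitalAlgebra.subset_adjoin k (Set.mem_insert _ _)
    | of x => exact NonUnitalAlgebra.subset_adjoin k (.inr ⟨x, rfl⟩)
    | add a b ha hb => exact add_mem ha hb
    | smul c a ha => exact SMulMemClass.smul_mem c ha
    | mul a b ha hb => exact mul_mem ha hb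

theorem isPrincipalAntihom_antipode :
    IsPrincipalAntihom k (Set.range (ι k L)) (antipode k L) where
  map_one := antipode_one k L
  map_mul := antipode_mul k L
  map_generator := by
    rintro _ ⟨x, rfl⟩
    exact antipode_ι k L x

end MaltsevAlgebra.Envelope

theorem proposition4p9_general (k L : Type*) [CommRing k] [AddCommGroup L] [Module k L]
    [MaltsevAlgebra k L] :
    IsHopfQuasigroup k (MaltsevAlgebra.Envelope k L) (MaltsevAlgebra.Envelope.antipode k L) ∧
      IsMoufang k (MaltsevAlgebra.Envelope k L) := by
  have hH := MaltsevAlgebra.Envelope.isNonassocBialgebra k L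
  have hs := MaltsevAlgebra.Envelope.isAltPrimitiveGenerating_range_ι k L
  have hS := MaltsevAlgebra.Envelope.isPrincipalAntihom_antipode k L
  exact ⟨hS.isHopfQuasigroup hs hH, hs.isMoufang hH⟩

theorem proposition4p9 (k L : Type*) [Field k] (h2 : (2 : k) ≠ 0) (h3 : (3 : k) ≠ 0)
    [AddCommGroup L] [Module k L] [MaltsevAlgebra k L] :
    IsHopfQuasigroup k (MaltsevAlgebra.Envelope k L) (MaltsevAlgebra.Envelope.antipode k L) ∧
      IsMoufang k (MaltsevAlgebra.Envelope k L) :=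
  proposition4p9_general k L
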